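/- Let $(\Omega,\mathcal F,\mathbb P)$ be a probability space with a filtration $(\mathcal F_t)_{t\ge 0}$, and let $B$ be a standard $d_w$-dimensional $(\mathcal F_t)$-Brownian motion. Let $f_h:\mathbb R\times\mathbb R^{d_x}\times\mathbb R^{d_w}\to\mathbb R^{d_x}$ be such that $(t,w)\mapsto f_h(t,h;w)$ is continuous for every $h$ and $f_h$ is globally Lipschitz in $h$, in the sense that for every $R$ there is a $K$ such that $h\mapsto f_h(t,h;w)$ is $K$-Lipschitz on $\mathbb R^{d_x}$ for all $t\in[0,1]$ and $\|w\|\le R$ (in particular, a single constant $K$ for all $t,w$ is allowed). Let $f_q:\mathbb R\times\mathbb R^{d_w}\to\mathbb R^{d_w}$ be continuous, and let $g_p:\mathbb R\times\mathbb R^{d_w}\to\mathbb R^{d_w\times d_w}$ be continuous in $t$, Lipschitz in $w$ uniformly in $t\in[0,1]$, and of linear growth, $\|g_p(t,w)\|\le C(1+\|w\|)$ for $t\in[0,1]$. Let $w$ be an adapted process that solves on $[0,1]$ the It\^o equation $$ dw_t=f_q(t,w_t)\,dt+g_p(t,w_t)\,dB_t,\qquad w_0=0. $$ Let $\mathcal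 L:\mathbb R^{d_x}\to\mathbb R$ be linear, let $0\le r_1<r_2<r_3$, let $A=\{x\in\mathbb R^{d_x}:\|x\|\le r_1\}\cup\{x\in\mathbb R^{d_x}:r_2\le\|x\|\le r_3\}$, and let $z=-1$ on $\{\|x\|\le r_1\}$ and $z=1$ on $\{r_2\le\|x\|\le r_3\}$. Then there is a flow $\psi$ of the hidden state, that is, a map $(t,\omega,x)\mapsto\psi_t(\omega,x)\in\mathbb R^{d_x}$ such that for almost every $\omega$ and every $x\in\mathbb R^{d_x}$ the path $h_t=\psi_t(\omega,x)$ solves on $[0,1]$ $$ dh_t=f_h(t,h_t;w_t(\omega))\,dt,\qquad h_0=x, $$ and every such flow satisfies $$ \mathbb P\Big(\sup_{x\in A}\big|\mathcal L(\psi_1(\omega,x))-z(x)\big|>\tfrac12\Big)=1. $$ -/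

import Mathlib

open MeasureTheory ProbabilityTheory Filter Topology
open scoped NNReal ENNReal

/-- `B` is a standard `d`-dimensional Brownian motion relative to the filtration `ℱ`: it is adapted,
its coordinates are independent real Brownian motions (started at `0`, with almost surely
continuous paths), and its increments after time `s` are independent of `ℱ s`. -/
structure IsStdBrownianMotion {Ω : Type*} {mΩ : MeasurableSpace Ω} (P : Measure Ω)
    (ℱ : Filtration ℝ≥0 mΩ) {d : ℕ} (B : ℝ≥0 → Ω → EuclideanSpace ℝ (Fin d)) : Prop where
  adapted : StronglyAdapted ℱ B
  coord : ∀ i : Fin d, IsBrownianReal (fun t ω => B t ω i) P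
  indep_coord : iIndepFun (fun (i : Fin d) (ω : Ω) (t : ℝ≥0) => B t ω i) P
  indep_incr : ∀ s t : ℝ≥0, s ≤ t →
    Indep (MeasurableSpace.comap (fun ω => B t ω - B s ω) inferInstance) (ℱ s) P

/-- A simple predictable process with values in `V`: the data of
`∑_{i < n} val i · 1_{(time i, time (i+1)]}` with deterministic times and `val i` bounded and
`ℱ (time i)`-measurable. -/
structure SimpleIntegrand {Ω : Type*} {mΩ : MeasurableSpace Ω} (ℱ : Filtration ℝ≥0 mΩ)
    (V : Type*) [NormedAddCommGroup V] where
  n : ℕ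
  time : ℕ → ℝ≥0
  time_mono : Monotone time
  val : ℕ → Ω → V
  measurable_val : ∀ i, StronglyMeasurable[ℱ (time i)] (val i)
  bounded_val : ∃ C : ℝ, ∀ i ω, ‖val i ω‖ ≤ C

namespace SimpleIntegrand

variable {Ω : Type*} {mΩ : MeasurableSpace Ω} {ℱ : Filtration ℝ≥0 mΩ}

/-- The value at time `t` of a simple process. -/
noncomputable def eval {V : Type*} [NormedAddCommGroup V] (H : SimpleIntegrand ℱ V)
    (t : ℝ≥0) (ω : Ω) : V :=
  ∑ i ∈ Finset.range H.n, (Set.Ioc (H.time i) (H.time (i + 1))).indicator (fun _ => H.val i ω) t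

/-- The stochastic integral `∫₀ᵗ H dB` of a simple operator-valued process. -/
noncomputable def integral {U W : Type*} [NormedAddCommGroup U] [NormedSpace ℝ U]
    [NormedAddCommGroup W] [NormedSpace ℝ W] (H : SimpleIntegrand ℱ (U →L[ℝ] W))
    (B : ℝ≥0 → Ω → U) (t : ℝ≥0) (ω : Ω) : W :=
  ∑ i ∈ Finset.range H.n,
    H.val i ω (B (min t (H.time (i + 1))) ω - B (min t (H.time i)) ω)

end SimpleIntegrand

/-- `I` is the Itô integral process `I t = ∫₀ᵗ σ dB` for `t ∈ [0,1]`: there are simple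
processes `H k` with `∫₀¹ ‖H k - σ‖² ds → 0` in probability and
`sup_{t ≤ 1} ‖∫₀ᵗ H k dB - I t‖ → 0` in probability. -/
structure IsItoIntegral {Ω : Type*} {mΩ : MeasurableSpace Ω} (P : Measure Ω)
    (ℱ : Filtration ℝ≥0 mΩ) {U W : Type*} [NormedAddCommGroup U] [NormedSpace ℝ U]
    [NormedAddCommGroup W] [NormedSpace ℝ W] (B : ℝ≥0 → Ω → U)
    (σ : ℝ≥0 → Ω → (U →L[ℝ] W)) (I : ℝ≥0 → Ω → W) : Prop where
  adapted : StronglyAdapted ℱ σ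
  measurable_path : ∀ᵐ ω ∂P, AEStronglyMeasurable (fun s : ℝ => σ s.toNNReal ω)
    (volume.restrict (Set.Icc (0 : ℝ) 1))
  sq_integrable : ∀ᵐ ω ∂P, ∫⁻ s in Set.Icc (0 : ℝ) 1, ‖σ s.toNNReal ω‖ₑ ^ 2 < ∞
  approx : ∃ H : ℕ → SimpleIntegrand ℱ (U →L[ℝ] W),
    (∀ ε : ℝ≥0∞, 0 < ε → Tendsto (fun k => P {ω | ε ≤
        ∫⁻ s in Set.Icc (0 : ℝ) 1, ‖(H k).eval s.toNNReal ω - σ s.toNNReal ω‖ₑ ^ 2})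
      atTop (𝓝 0)) ∧
    (∀ ε : ℝ, 0 < ε → Tendsto (fun k => P {ω | ∃ t : ℝ≥0, t ≤ 1 ∧
        ε ≤ ‖(H k).integral B t ω - I t ω‖})
      atTop (𝓝 0))

/-- `w` solves `dw_t = f(t, w_t) dt + g(t, w_t) dB_t`, `w_0 = w₀`, on the time interval `[0,1]`. -/
structure IsSDESolution {Ω : Type*} {mΩ : MeasurableSpace Ω} (P : Measure Ω)
    (ℱ : Filtration ℝ≥0 mΩ) {U W : Type*} [NormedAddCommGroup U] [NormedSpace ℝ U]
    [NormedAddCommGroup W] [NormedSpace ℝ W] (B : ℝ≥0 → Ω → U)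
    (f : ℝ → W → W) (g : ℝ → W → (U →L[ℝ] W)) (w₀ : W) (w : ℝ≥0 → Ω → W) : Prop where
  adapted : StronglyAdapted ℱ w
  drift_integrable : ∀ᵐ ω ∂P,
    IntervalIntegrable (fun s : ℝ => f s (w s.toNNReal ω)) volume 0 1
  integral_eq : ∃ I : ℝ≥0 → Ω → W, IsItoIntegral P ℱ B (fun s ω => g s (w s ω)) I ∧
    ∀ᵐ ω ∂P, ∀ t : ℝ≥0, t ≤ 1 →
      w t ω = w₀ + (∫ s in (0 : ℝ)..t, f s (w s.toNNReal ω)) + I t ω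

/-- `h` solves the ordinary differential equation `dh_t = f(t, h_t; v_t) dt`, `h_0 = x`, on `[0,1]`,
in integral form, for a fixed weight path `v`. -/
def IsHiddenPath {E W : Type*} [NormedAddCommGroup E] [NormedSpace ℝ E]
    (f : ℝ → E → W → E) (v : ℝ≥0 → W) (x : E) (h : ℝ≥0 → E) : Prop :=
  IntervalIntegrable (fun s : ℝ => f s (h s.toNNReal) (v s.toNNReal)) volume 0 1 ∧
    ∀ t : ℝ≥0, t ≤ 1 → h t = x + ∫ s in (0 : ℝ)..t, f s (h s.toNNReal) (v s.toNNReal)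

/-- `ψ t ω x` is the flow of the hidden state driven by the weight process `w`: for almost every `ω`
and every initial value `x`, `t ↦ ψ t ω x` solves the hidden-state equation along `w · ω`
started at `x`. -/
def IsHiddenFlow {Ω : Type*} {mΩ : MeasurableSpace Ω} (P : Measure Ω)
    {E W : Type*} [NormedAddCommGroup E] [NormedSpace ℝ E]
    (f : ℝ → E → W → E) (w : ℝ≥0 → Ω → W) (ψ : ℝ≥0 → Ω → E → E) : Prop :=
  ∀ᵐ ω ∂P, ∀ x : E, IsHiddenPath f (fun t => w t ω) x (fun t => ψ t ω x)

/-! Fix `ω` with a continuous weight path. On `[0,1]` the weights are bounded, so the hidden field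
is globally Lipschitz, and its time-one map is a homeomorphism of the whole space: solving backwards
in time inverts it. For `L ≠ 0` the function `L ∘ ψ₁` therefore has no interior minimum on a ball,
so its minimum over the ball of radius `r₂` is attained on the sphere (`exists_norm_eq_le_of_flow`).
An error of at most `1/2` would make `L ∘ ψ₁` at most `-1/2` at the centre but at least `1/2` on
that sphere, which is impossible. Probability enters only through the continuity of `w`, which an
Itô integral inherits from Brownian paths as an almost sure uniform limit. -/

/-! ### Flows of globally Lipschitz fields on `[0,1]`. -/

section GlobalFlow

variable {d : ℕ}

/-- Coordinatewise truncation of a vector to the cube `[-R, R]^d`. -/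
noncomputable def cubeClamp (R : ℝ) (x : EuclideanSpace ℝ (Fin d)) : EuclideanSpace ℝ (Fin d) :=
  WithLp.toLp 2 fun i => max (-R) (min R (x i))

lemma lipschitzWith_cubeClamp (R : ℝ) :
    LipschitzWith 1 (cubeClamp R : EuclideanSpace ℝ (Fin d) → EuclideanSpace ℝ (Fin d)) := by
  refine LipschitzWith.of_dist_le_mul fun x y => ?_
  rw [NNReal.coe_one, one_mul, EuclideanSpace.dist_eq, EuclideanSpace.dist_eq]
  refine Real.sqrt_le_sqrt (Finset.sum_le_sum fun i _ => ?_)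
  refine pow_le_pow_left₀ dist_nonneg ?_ 2
  simp only [cubeClamp, Real.dist_eq]
  calc |max (-R) (min R (x i)) - max (-R) (min R (y i))|
      ≤ |min R (x i) - min R (y i)| := by
        simpa using abs_max_sub_max_le_max (-R) (min R (x i)) (-R) (min R (y i))
    _ ≤ |x i - y i| := by
        simpa using abs_min_sub_min_le_max R (x i) R (y i)

lemma cubeClamp_zero {R : ℝ} (hR : 0 ≤ R) : cubeClamp R (0 : EuclideanSpace ℝ (Fin d)) = 0 := by
  ext i
  simp [cubeClamp, hR]

lemma norm_cubeClamp_le {R : ℝ} (hR : 0 ≤ R) (x : EuclideanSpace ℝ (Fin d)) :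
    ‖cubeClamp R x‖ ≤ ‖x‖ := by
  have h := (lipschitzWith_cubeClamp (d := d) R).dist_le_mul x 0
  simpa [cubeClamp_zero hR] using h

lemma norm_cubeClamp_le_sqrt {R : ℝ} (hR : 0 ≤ R) (x : EuclideanSpace ℝ (Fin d)) :
    ‖cubeClamp R x‖ ≤ √(d * R ^ 2) := by
  rw [EuclideanSpace.norm_eq]
  refine Real.sqrt_le_sqrt ?_
  calc ∑ i, ‖cubeClamp R x i‖ ^ 2 ≤ ∑ _i : Fin d, R ^ 2 := by
        refine Finset.sum_le_sum fun i _ => pow_le_pow_left₀ (norm_nonneg _) ?_ 2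
        rw [Real.norm_eq_abs, abs_le]
        exact ⟨le_max_left _ _, max_le (by linarith) (min_le_left _ _)⟩
    _ = d * R ^ 2 := by simp

lemma cubeClamp_eq_self {R : ℝ} {x : EuclideanSpace ℝ (Fin d)} (hx : ‖x‖ ≤ R) :
    cubeClamp R x = x := by
  ext i
  have h := abs_le.1 ((PiLp.norm_apply_le x i).trans hx)
  simp [cubeClamp, h.1, h.2]

variable {F : ℝ → EuclideanSpace ℝ (Fin d) → EuclideanSpace ℝ (Fin d)} {K : ℝ≥0}

lemma IsIntegralCurveOn.hasDerivWithinAt_Ici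
    {α : ℝ → EuclideanSpace ℝ (Fin d)} (h : IsIntegralCurveOn α F (Set.Icc 0 1))
    {t : ℝ} (ht : t ∈ Set.Ico (0 : ℝ) 1) : HasDerivWithinAt α (F t (α t)) (Set.Ici t) t :=
  (h t ⟨ht.1, ht.2.le⟩).mono_of_mem_nhdsWithin
    (mem_of_superset (Icc_mem_nhdsGE ht.2) (Set.Icc_subset_Icc_left ht.1))

/-- A globally Lipschitz vector field has an integral curve on `[0,1]` from each initial value. -/
theorem exists_isIntegralCurveOn_of_lipschitzWith (hlip : ∀ t, LipschitzWith K (F t))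
    (hcont : ∀ x, Continuous fun t => F t x) (x : EuclideanSpace ℝ (Fin d)) :
    ∃ α : ℝ → EuclideanSpace ℝ (Fin d), α 0 = x ∧ IsIntegralCurveOn α F (Set.Icc 0 1) := by
  obtain ⟨M, hM⟩ := (isCompact_Icc (a := (0 : ℝ)) (b := 1)).exists_bound_of_continuousOn
    (hcont 0).continuousOn
  have hM0 : 0 ≤ M := (norm_nonneg _).trans (hM 0 (by simp))
  have hgrow : ∀ t ∈ Set.Icc (0 : ℝ) 1, ∀ y, ‖F t y‖ ≤ K * ‖y‖ + M := fun t ht y => by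
    have h1 := (hlip t).dist_le_mul y 0
    rw [dist_eq_norm, dist_zero_right] at h1
    have h2 := norm_le_norm_sub_add (F t y) (F t 0)
    linarith [hM t ht]
  -- Truncation does not increase norms, so the truncated field keeps the linear growth bound.
  -- Grönwall then confines its solution to the ball of radius `R`, where truncation is the
  -- identity.
  set R := max (gronwallBound ‖x‖ K M 1) 0 with hRdef
  have hR : 0 ≤ R := le_max_right _ _
  set C : ℝ≥0 := (K * √(d * R ^ 2) + M).toNNReal with hC
  -- The truncated field is bounded by `C`, so the ball of radius `C` suffices for the whole unit
  -- time interval.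
  have hPL : IsPicardLindelof (fun t y => F t (cubeClamp R y))
      (tmin := 0) (tmax := 1) ⟨0, by simp⟩ x C 0 C K := by
    refine ⟨fun t _ => ?_, fun y _ => (hcont _).continuousOn, fun t ht y _ => ?_, ?_⟩
    · have h := (hlip t).comp (lipschitzWith_cubeClamp R)
      rw [mul_one] at h
      exact h.lipschitzOnWith
    · refine (hgrow t ht _).trans ?_
      rw [hC, Real.coe_toNNReal _ (by positivity)]
      gcongr
      exact norm_cubeClamp_le_sqrt hR y
    · simp
  obtain ⟨α, hα0, hα⟩ := hPL.exists_eq_forall_mem_Icc_hasDerivWithinAt₀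
  have hα' : IsIntegralCurveOn α (fun t y => F t (cubeClamp R y)) (Set.Icc 0 1) := hα
  have hbound : ∀ t ∈ Set.Icc (0 : ℝ) 1, ‖α t‖ ≤ R := fun t ht => by
    have h := norm_le_gronwallBound_of_norm_deriv_right_le (δ := ‖x‖) (K := K) (ε := M)
      (fun t ht => (hα t ht).continuousWithinAt)
      (fun t ht => hα'.hasDerivWithinAt_Ici ht) (by rw [hα0])
      (fun t ht => (hgrow t ⟨ht.1, ht.2.le⟩ _).trans (by
        gcongr
        exact norm_cubeClamp_le hR _)) t ht
    exact (h.trans (gronwallBound_mono (norm_nonneg _) hM0 K.2 (by linarith [ht.2]))).trans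
      (le_max_left _ _)
  refine ⟨α, hα0, fun t ht => ?_⟩
  have h := hα t ht
  rwa [cubeClamp_eq_self (hbound t ht)] at h

/-- Two integral curves of a Lipschitz field separate at most exponentially. -/
lemma IsIntegralCurveOn.dist_one_le (hlip : ∀ t, LipschitzWith K (F t))
    {α β : ℝ → EuclideanSpace ℝ (Fin d)} (hα : IsIntegralCurveOn α F (Set.Icc 0 1))
    (hβ : IsIntegralCurveOn β F (Set.Icc 0 1)) :
    dist (α 1) (β 1) ≤ dist (α 0) (β 0) * Real.exp K := by
  have h := dist_le_of_trajectories_ODE hlip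
    (fun t ht => (hα t ht).continuousWithinAt) (fun t ht => hα.hasDerivWithinAt_Ici ht)
    (fun t ht => (hβ t ht).continuousWithinAt) (fun t ht => hβ.hasDerivWithinAt_Ici ht)
    le_rfl 1 (by simp)
  simpa using h

/-- Time reversal turns forward existence and stability into surjectivity of the time-one map and a
Lipschitz bound for its inverse. -/
lemma IsIntegralCurveOn.reverse {α : ℝ → EuclideanSpace ℝ (Fin d)}
    (hα : IsIntegralCurveOn α F (Set.Icc 0 1)) :
    IsIntegralCurveOn (fun t => α (1 - t)) (fun t y => -F (1 - t) y) (Set.Icc 0 1) := by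
  intro t ht
  have hmaps : Set.MapsTo (fun s : ℝ => 1 - s) (Set.Icc 0 1) (Set.Icc 0 1) := fun s hs =>
    ⟨by linarith [hs.2], by linarith [hs.1]⟩
  have h := (hα (1 - t) (hmaps ht)).scomp t
    ((hasDerivWithinAt_id t (Set.Icc (0 : ℝ) 1)).const_sub 1) hmaps
  simpa [Function.comp_def] using h

lemma IsIntegralCurveOn.dist_zero_le (hlip : ∀ t, LipschitzWith K (F t))
    {α β : ℝ → EuclideanSpace ℝ (Fin d)} (hα : IsIntegralCurveOn α F (Set.Icc 0 1))
    (hβ : IsIntegralCurveOn β F (Set.Icc 0 1)) :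
    dist (α 0) (β 0) ≤ dist (α 1) (β 1) * Real.exp K := by
  have h := hα.reverse.dist_one_le (K := K) (fun t => (hlip (1 - t)).neg) hβ.reverse
  simpa using h

/-- A globally Lipschitz vector field has an integral curve on `[0,1]` to each final value. -/
theorem exists_isIntegralCurveOn_final (hlip : ∀ t, LipschitzWith K (F t))
    (hcont : ∀ x, Continuous fun t => F t x) (y : EuclideanSpace ℝ (Fin d)) :
    ∃ α : ℝ → EuclideanSpace ℝ (Fin d), α 1 = y ∧ IsIntegralCurveOn α F (Set.Icc 0 1) := by
  obtain ⟨α, hα0, hα⟩ := exists_isIntegralCurveOn_of_lipschitzWith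
    (F := fun t y => -F (1 - t) y) (K := K) (fun t => (hlip (1 - t)).neg)
    (fun x => ((hcont x).comp (continuous_const.sub continuous_id)).neg) y
  refine ⟨fun t => α (1 - t), by simpa using hα0, ?_⟩
  simpa using hα.reverse

/-- A linear functional cannot separate the centre of a ball from its bounding sphere after the
flow of a globally Lipschitz vector field. -/
theorem exists_norm_eq_le_of_flow (hlip : ∀ t, LipschitzWith K (F t))
    (hcont : ∀ x, Continuous fun t => F t x)
    {α : EuclideanSpace ℝ (Fin d) → ℝ → EuclideanSpace ℝ (Fin d)}
    (hα0 : ∀ x, α x 0 = x) (hα : ∀ x, IsIntegralCurveOn (α x) F (Set.Icc 0 1))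
    {L : EuclideanSpace ℝ (Fin d) →ₗ[ℝ] ℝ} (hL : L ≠ 0) {r : ℝ} (hr : 0 ≤ r) :
    ∃ x, ‖x‖ = r ∧ L (α x 1) ≤ L (α 0 1) := by
  have hcontα : Continuous fun x => α x 1 := by
    refine (LipschitzWith.of_dist_le_mul (K := (Real.exp K).toNNReal)
      fun x y => ?_).continuous
    have h := (hα x).dist_one_le hlip (hα y)
    rw [hα0, hα0, mul_comm] at h
    rw [Real.coe_toNNReal _ (Real.exp_pos _).le]
    exact h
  obtain ⟨x, hx, hmin⟩ := (isCompact_closedBall (0 : EuclideanSpace ℝ (Fin d)) r).exists_isMinOn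
    ⟨0, by simpa using hr⟩ (L.continuous_of_finiteDimensional.comp hcontα).continuousOn
  refine ⟨x, ?_, hmin (by simpa using hr)⟩
  rw [mem_closedBall_zero_iff] at hx
  by_contra hne
  have hlt : ‖x‖ < r := lt_of_le_of_ne hx hne
  obtain ⟨e, he⟩ : ∃ e, L e ≠ 0 := by
    by_contra! h
    exact hL (LinearMap.ext h)
  -- The endpoint will be moved by `-s • L e • e`, which lowers `L` by `s * (L e)²`. For small `s`
  -- the backward estimate keeps the initial point inside the ball.
  have key : ∀ᶠ s in 𝓝[>] (0 : ℝ), s * (‖L e • e‖ * Real.exp K) < r - ‖x‖ := by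
    have : Tendsto (fun s : ℝ => s * (‖L e • e‖ * Real.exp K)) (𝓝[>] 0)
        (𝓝 (0 * (‖L e • e‖ * Real.exp K))) :=
      ((continuous_id.mul continuous_const).tendsto 0).mono_left nhdsWithin_le_nhds
    exact this.eventually_lt_const (by rw [zero_mul]; linarith)
  obtain ⟨s, hs, (hs0 : 0 < s)⟩ := (key.and self_mem_nhdsWithin).exists
  obtain ⟨β, hβ1, hβ⟩ := exists_isIntegralCurveOn_final hlip hcont (α x 1 - s • L e • e)
  have hβα : α (β 0) 1 = β 1 := by
    have h := (hα (β 0)).dist_one_le hlip hβ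
    rw [hα0, dist_self, zero_mul] at h
    exact dist_le_zero.1 h
  have hdist : dist (β 0) x ≤ s * (‖L e • e‖ * Real.exp K) := by
    have h := hβ.dist_zero_le hlip (hα x)
    rw [hα0, hβ1, dist_eq_norm (_ - _), sub_sub_cancel_left, norm_neg, norm_smul,
      Real.norm_of_nonneg hs0.le, mul_assoc] at h
    exact h
  have hmem : β 0 ∈ Metric.closedBall (0 : EuclideanSpace ℝ (Fin d)) r := by
    rw [mem_closedBall_zero_iff]
    have h := norm_le_norm_sub_add (β 0) x
    rw [← dist_eq_norm] at h
    linarith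
  have h := isMinOn_iff.1 hmin _ hmem
  simp only [Function.comp_apply, hβα, hβ1, map_sub, map_smul, smul_eq_mul] at h
  have : 0 < s * (L e * L e) := mul_pos hs0 (mul_self_pos.2 he)
  linarith

end GlobalFlow

/-! ### Integral equation versus integral curves. -/

section HiddenPath

variable {d : ℕ} {W : Type*} {F : ℝ → EuclideanSpace ℝ (Fin d) → EuclideanSpace ℝ (Fin d)}
  {f : ℝ → EuclideanSpace ℝ (Fin d) → W → EuclideanSpace ℝ (Fin d)} {v : ℝ≥0 → W}

/-- Integrability alone makes the path continuous, being a primitive; the integrand is then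
continuous and the path differentiable. -/
lemma IsHiddenPath.isIntegralCurveOn (hF : Continuous (Function.uncurry F))
    (hFf : ∀ t ∈ Set.Icc (0 : ℝ) 1, ∀ y, F t y = f t y (v t.toNNReal))
    {x : EuclideanSpace ℝ (Fin d)} {h : ℝ≥0 → EuclideanSpace ℝ (Fin d)}
    (hh : IsHiddenPath f v x h) :
    IsIntegralCurveOn (fun t => h t.toNNReal) F (Set.Icc 0 1) := by
  obtain ⟨hint, heq⟩ := hh
  have heq' : ∀ t ∈ Set.Icc (0 : ℝ) 1, h t.toNNReal =
      x + ∫ s in (0 : ℝ)..t, f s (h s.toNNReal) (v s.toNNReal) := fun t ht => by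
    have h1 := heq t.toNNReal (by simpa using ht.2)
    rwa [Real.coe_toNNReal _ ht.1] at h1
  have hcont : ContinuousOn (fun t : ℝ => h t.toNNReal) (Set.Icc 0 1) := by
    refine ContinuousOn.congr (continuousOn_const.add ?_) heq'
    have h1 := intervalIntegral.continuousOn_primitive_interval' hint Set.left_mem_uIcc
    rwa [Set.uIcc_of_le zero_le_one] at h1
  intro t ht
  have h1 := ODE.hasDerivWithinAt_picard_Icc (f := F) (u := Set.univ) (Set.left_mem_Icc.2 zero_le_one)
    hF.continuousOn hcont (fun _ _ => Set.mem_univ _) x ht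
  refine h1.congr_of_mem (fun s hs => ?_) ht
  rw [heq' s hs, ODE.picard_apply]
  congr 1
  refine intervalIntegral.integral_congr fun r hr => ?_
  rw [Set.uIcc_of_le hs.1] at hr
  exact (hFf r ⟨hr.1, hr.2.trans hs.2⟩ _).symm

lemma IsIntegralCurveOn.isHiddenPath (hF : Continuous (Function.uncurry F))
    (hFf : ∀ t ∈ Set.Icc (0 : ℝ) 1, ∀ y, F t y = f t y (v t.toNNReal))
    {α : ℝ → EuclideanSpace ℝ (Fin d)} (hα : IsIntegralCurveOn α F (Set.Icc 0 1)) :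
    IsHiddenPath f v (α 0) (fun t => α t) := by
  have hcont : ContinuousOn α (Set.Icc 0 1) := fun t ht => (hα t ht).continuousWithinAt
  have hFα : ContinuousOn (fun t => F t (α t)) (Set.Icc 0 1) :=
    hF.comp_continuousOn (continuousOn_id.prodMk hcont)
  have hcongr : Set.EqOn (fun t => F t (α t))
      (fun s : ℝ => f s (α s.toNNReal) (v s.toNNReal)) (Set.Icc 0 1) := fun s hs => by
    simp only [hFf s hs, Real.coe_toNNReal s hs.1]
  refine ⟨?_, fun t ht => ?_⟩
  · refine ContinuousOn.intervalIntegrable ?_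
    rw [Set.uIcc_of_le zero_le_one]
    exact hFα.congr hcongr.symm
  · have ht1 : Set.uIcc (0 : ℝ) t ⊆ Set.Icc 0 1 := by
      rw [Set.uIcc_of_le (NNReal.coe_nonneg t)]
      exact Set.Icc_subset_Icc_right ht
    have h1 := ODE.picard_eq_of_hasDerivAt (u := Set.univ) hF.continuousOn
      (fun s hs => (hα s (ht1 hs)).mono ht1) (Set.mapsTo_univ _ _)
    refine h1.symm.trans ?_
    rw [ODE.picard_apply]
    congr 1
    exact intervalIntegral.integral_congr fun r hr => hcongr (ht1 hr)

end HiddenPath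

/-! ### Continuity of the weight paths. -/

section PathContinuity

variable {Ω : Type*} {mΩ : MeasurableSpace Ω} {P : Measure Ω} {ℱ : Filtration ℝ≥0 mΩ}

lemma IsStdBrownianMotion.ae_continuous {d : ℕ} {B : ℝ≥0 → Ω → EuclideanSpace ℝ (Fin d)}
    (hB : IsStdBrownianMotion P ℱ B) : ∀ᵐ ω ∂P, Continuous fun t => B t ω := by
  filter_upwards [ae_all_iff.2 fun i => (hB.coord i).cont] with ω hω
  exact (PiLp.continuous_toLp 2 fun _ : Fin d => ℝ).comp (continuous_pi hω)

variable {U W : Type*} [NormedAddCommGroup U] [NormedSpace ℝ U]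
  [NormedAddCommGroup W] [NormedSpace ℝ W] {B : ℝ≥0 → Ω → U}

lemma SimpleIntegrand.continuous_integral (H : SimpleIntegrand ℱ (U →L[ℝ] W)) {ω : Ω}
    (hB : Continuous fun t => B t ω) : Continuous fun t => H.integral B t ω := by
  unfold SimpleIntegrand.integral
  refine continuous_finsetSum _ fun i _ => (H.val i ω).continuous.comp ?_
  exact (hB.comp (continuous_id.min continuous_const)).sub
    (hB.comp (continuous_id.min continuous_const))

/-- An Itô integral process against an integrator with continuous paths has continuous paths. -/
theorem IsItoIntegral.ae_continuousOn {σ : ℝ≥0 → Ω → (U →L[ℝ] W)} {I : ℝ≥0 → Ω → W}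
    (hI : IsItoIntegral P ℱ B σ I) (hB : ∀ᵐ ω ∂P, Continuous fun t => B t ω) :
    ∀ᵐ ω ∂P, ContinuousOn (fun t => I t ω) (Set.Iic 1) := by
  obtain ⟨H, -, hH⟩ := hI.approx
  -- Errors `1/(n+1)` with summable probabilities `2⁻¹ ^ n` set up Borel–Cantelli, giving almost
  -- sure uniform convergence along a subsequence.
  have hk : ∀ n : ℕ, ∃ k, P {ω | ∃ t : ℝ≥0, t ≤ 1 ∧
      1 / ((n : ℝ) + 1) ≤ ‖(H k).integral B t ω - I t ω‖} ≤ 2⁻¹ ^ n := fun n =>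
    ((hH _ Nat.one_div_pos_of_nat).eventually_le_const
      (ENNReal.pow_pos (by simp) n)).exists
  choose k hk using hk
  have hsum : ∑' n : ℕ, P {ω | ∃ t : ℝ≥0, t ≤ 1 ∧
      1 / ((n : ℝ) + 1) ≤ ‖(H (k n)).integral B t ω - I t ω‖} ≠ ∞ := by
    refine ne_top_of_le_ne_top ?_ (ENNReal.tsum_le_tsum hk)
    rw [ENNReal.tsum_geometric]
    simp
  filter_upwards [hB, ae_eventually_notMem hsum] with ω hBω hω
  have hunif : TendstoUniformlyOn (fun n t => (H (k n)).integral B t ω) (fun t => I t ω)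
      atTop (Set.Iic 1) := by
    rw [Metric.tendstoUniformlyOn_iff]
    intro ε hε
    filter_upwards [hω, tendsto_one_div_add_atTop_nhds_zero_nat.eventually_lt_const hε]
      with n hn hnε t ht
    rw [dist_comm, dist_eq_norm]
    by_contra! hcon
    exact hn ⟨t, ht, hnε.le.trans hcon⟩
  exact hunif.continuousOn
    (Frequently.of_forall fun n => ((H (k n)).continuous_integral hBω).continuousOn)

/-- Solutions of a stochastic differential equation have continuous paths. -/
theorem IsSDESolution.ae_continuousOn {f : ℝ → W → W} {g : ℝ → W → (U →L[ℝ] W)} {w₀ : W}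
    {w : ℝ≥0 → Ω → W} (hw : IsSDESolution P ℱ B f g w₀ w)
    (hB : ∀ᵐ ω ∂P, Continuous fun t => B t ω) :
    ∀ᵐ ω ∂P, ContinuousOn (fun t => w t ω) (Set.Iic 1) := by
  obtain ⟨I, hI, heq⟩ := hw.integral_eq
  filter_upwards [hw.drift_integrable, heq, hI.ae_continuousOn hB] with ω hd hω hIω
  refine ContinuousOn.congr (f := fun t : ℝ≥0 =>
    w₀ + (∫ s in (0 : ℝ)..t, f s (w s.toNNReal ω)) + I t ω) ?_ hω
  refine (continuousOn_const.add ?_).add hIω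
  have h1 := intervalIntegral.continuousOn_primitive_interval' hd Set.left_mem_uIcc
  rw [Set.uIcc_of_le zero_le_one] at h1
  exact h1.comp NNReal.continuous_coe.continuousOn fun t ht => ⟨t.2, ht⟩

end PathContinuity

/-- Along a continuous weight path, the hidden-state vector field agrees on `[0,1]` with one that is
globally Lipschitz and continuous in time. -/
theorem exists_lipschitz_field {E W : Type*} [NormedAddCommGroup E] [NormedAddCommGroup W]
    {f : ℝ → E → W → E}
    (hlip : ∀ R : ℝ, ∃ K : ℝ≥0, ∀ t ∈ Set.Icc (0 : ℝ) 1, ∀ v : W, ‖v‖ ≤ R →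
      LipschitzWith K (fun h => f t h v))
    (hcont : ∀ h : E, Continuous (fun p : ℝ × W => f p.1 h p.2))
    {v : ℝ≥0 → W} (hv : ContinuousOn v (Set.Iic 1)) :
    ∃ (K : ℝ≥0) (F : ℝ → E → E), (∀ t, LipschitzWith K (F t)) ∧
      (∀ x, Continuous fun t => F t x) ∧
      ∀ t ∈ Set.Icc (0 : ℝ) 1, ∀ y, F t y = f t y (v t.toNNReal) := by
  have hIic : IsCompact (Set.Iic (1 : ℝ≥0)) := by
    have : Set.Iic (1 : ℝ≥0) = Set.Icc 0 1 := by ext; simp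
    rw [this]
    exact isCompact_Icc
  obtain ⟨R, hR⟩ := hIic.exists_bound_of_continuousOn hv
  obtain ⟨K, hK⟩ := hlip R
  -- Projecting time onto `[0,1]` freezes the field outside the interval, so the bounds hold for all
  -- real times.
  have hproj : ∀ t : ℝ, (Set.projIcc (0 : ℝ) 1 zero_le_one t : ℝ).toNNReal ∈ Set.Iic (1 : ℝ≥0) :=
    fun t => by simpa using (Set.projIcc (0 : ℝ) 1 zero_le_one t).2.2
  have hpc : Continuous fun t : ℝ => (Set.projIcc (0 : ℝ) 1 zero_le_one t : ℝ) :=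
    continuous_subtype_val.comp continuous_projIcc
  refine ⟨K, fun t y => f (Set.projIcc (0 : ℝ) 1 zero_le_one t) y
    (v (Set.projIcc (0 : ℝ) 1 zero_le_one t : ℝ).toNNReal), fun t => ?_, fun x => ?_,
    fun t ht y => ?_⟩
  · exact hK _ (Set.projIcc (0 : ℝ) 1 zero_le_one t).2 _ (hR _ (hproj t))
  · exact (hcont x).comp (hpc.prodMk
      (hv.comp_continuous (continuous_real_toNNReal.comp hpc) hproj))
  · simp only [Set.projIcc_of_mem zero_le_one ht]

theorem mainTheorem2 {Ω : Type*} {mΩ : MeasurableSpace Ω} (P : Measure Ω) [IsProbabilityMeasure P]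
    (ℱ : Filtration ℝ≥0 mΩ) (dx dw : ℕ)
    (B : ℝ≥0 → Ω → EuclideanSpace ℝ (Fin dw)) (hB : IsStdBrownianMotion P ℱ B)
    (f_h : ℝ → EuclideanSpace ℝ (Fin dx) → EuclideanSpace ℝ (Fin dw) → EuclideanSpace ℝ (Fin dx))
    (hfh_lip : ∀ R : ℝ, ∃ K : ℝ≥0, ∀ t ∈ Set.Icc (0 : ℝ) 1,
      ∀ v : EuclideanSpace ℝ (Fin dw), ‖v‖ ≤ R → LipschitzWith K (fun h => f_h t h v))
    (hfh_cont : ∀ h : EuclideanSpace ℝ (Fin dx),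
      Continuous (fun p : ℝ × EuclideanSpace ℝ (Fin dw) => f_h p.1 h p.2))
    (f_q : ℝ → EuclideanSpace ℝ (Fin dw) → EuclideanSpace ℝ (Fin dw))
    (hfq_cont : Continuous (fun p : ℝ × EuclideanSpace ℝ (Fin dw) => f_q p.1 p.2))
    (g_p : ℝ → EuclideanSpace ℝ (Fin dw) →
      (EuclideanSpace ℝ (Fin dw) →L[ℝ] EuclideanSpace ℝ (Fin dw)))
    (hgp_lip : ∃ K : ℝ≥0, ∀ t ∈ Set.Icc (0 : ℝ) 1, LipschitzWith K (g_p t))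
    (hgp_cont : ∀ v : EuclideanSpace ℝ (Fin dw), Continuous (fun t => g_p t v))
    (hgp_growth : ∃ C : ℝ, ∀ t ∈ Set.Icc (0 : ℝ) 1, ∀ v : EuclideanSpace ℝ (Fin dw),
      ‖g_p t v‖ ≤ C * (1 + ‖v‖))
    (w : ℝ≥0 → Ω → EuclideanSpace ℝ (Fin dw)) (hw : IsSDESolution P ℱ B f_q g_p 0 w)
    (L : EuclideanSpace ℝ (Fin dx) →ₗ[ℝ] ℝ)
    (r₁ r₂ r₃ : ℝ) (hr₁ : 0 ≤ r₁) (hr₁₂ : r₁ < r₂) (hr₂₃ : r₂ < r₃)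
    (z : EuclideanSpace ℝ (Fin dx) → ℝ)
    (hz_ball : ∀ x, ‖x‖ ≤ r₁ → z x = -1)
    (hz_annulus : ∀ x, r₂ ≤ ‖x‖ → ‖x‖ ≤ r₃ → z x = 1) :
    (∃ ψ : ℝ≥0 → Ω → EuclideanSpace ℝ (Fin dx) → EuclideanSpace ℝ (Fin dx),
      IsHiddenFlow P f_h w ψ) ∧
    ∀ ψ : ℝ≥0 → Ω → EuclideanSpace ℝ (Fin dx) → EuclideanSpace ℝ (Fin dx),
      IsHiddenFlow P f_h w ψ →
        ∀ᵐ ω ∂P, (1 / 2 : ℝ≥0∞) <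
          ⨆ x ∈ {x : EuclideanSpace ℝ (Fin dx) | ‖x‖ ≤ r₁} ∪ {x | r₂ ≤ ‖x‖ ∧ ‖x‖ ≤ r₃},
            ENNReal.ofReal |L (ψ 1 ω x) - z x| := by
  have hflow : ∀ᵐ ω ∂P, ∃ (K : ℝ≥0)
      (F : ℝ → EuclideanSpace ℝ (Fin dx) → EuclideanSpace ℝ (Fin dx)),
      (∀ t, LipschitzWith K (F t)) ∧ (∀ x, Continuous fun t => F t x) ∧
      ∀ t ∈ Set.Icc (0 : ℝ) 1, ∀ y, F t y = f_h t y (w t.toNNReal ω) := by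
    filter_upwards [hw.ae_continuousOn hB.ae_continuous] with ω hω
    exact exists_lipschitz_field hfh_lip hfh_cont hω
  have hjoint : ∀ {K : ℝ≥0} {F : ℝ → EuclideanSpace ℝ (Fin dx) → EuclideanSpace ℝ (Fin dx)},
      (∀ t, LipschitzWith K (F t)) → (∀ x, Continuous fun t => F t x) →
      Continuous (Function.uncurry F) := fun {K F} h1 h2 =>
    continuous_prod_of_continuous_lipschitzWith' _ K h1 h2
  refine ⟨?_, fun ψ hψ => ?_⟩
  -- Paths are chosen separately for each `ω` and `x`, with the junk value `0` where none exists; a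
  -- flow need not be measurable in `ω`.
  · have hex : ∀ ω x, ∃ h : ℝ≥0 → EuclideanSpace ℝ (Fin dx),
        (∃ h', IsHiddenPath f_h (fun t => w t ω) x h') →
          IsHiddenPath f_h (fun t => w t ω) x h := fun ω x => by
      by_cases h : ∃ h', IsHiddenPath f_h (fun t => w t ω) x h'
      · exact ⟨h.choose, fun _ => h.choose_spec⟩
      · exact ⟨0, fun h' => absurd h' h⟩
    choose h hh using hex
    refine ⟨fun t ω x => h ω x t, ?_⟩
    filter_upwards [hflow] with ω ⟨K, F, hlip, hcont, hFf⟩ x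
    obtain ⟨α, hα0, hα⟩ := exists_isIntegralCurveOn_of_lipschitzWith hlip hcont x
    refine hh ω x ⟨fun t => α t, ?_⟩
    rw [← hα0]
    exact hα.isHiddenPath (hjoint hlip hcont) hFf
  · filter_upwards [hflow, hψ] with ω ⟨K, F, hlip, hcont, hFf⟩ hω
    by_contra! hsup
    have hle : ∀ x ∈ {x : EuclideanSpace ℝ (Fin dx) | ‖x‖ ≤ r₁} ∪ {x | r₂ ≤ ‖x‖ ∧ ‖x‖ ≤ r₃},
        |L (ψ 1 ω x) - z x| ≤ 1 / 2 := fun x hx => by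
      have h1 := (le_iSup₂ (f := fun x (_ : x ∈ {x : EuclideanSpace ℝ (Fin dx) | ‖x‖ ≤ r₁} ∪
        {x | r₂ ≤ ‖x‖ ∧ ‖x‖ ≤ r₃}) => ENNReal.ofReal |L (ψ 1 ω x) - z x|) x hx).trans hsup
      have h2 : (1 / 2 : ℝ≥0∞) = ENNReal.ofReal (1 / 2) := by
        rw [ENNReal.ofReal_div_of_pos two_pos]; simp
      rw [h2] at h1
      exact (ENNReal.ofReal_le_ofReal_iff (by norm_num)).1 h1
    have hzero : L (ψ 1 ω 0) ≤ -1 / 2 := by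
      have h1 := hle 0 (Or.inl (by simpa using hr₁))
      rw [hz_ball 0 (by simpa using hr₁), abs_le] at h1
      linarith [h1.2]
    -- The zero functional already fails at the centre.
    have hL : L ≠ 0 := by
      rintro rfl
      norm_num at hzero
    have hψ0 : ∀ x, ψ (0 : ℝ).toNNReal ω x = x := fun x => by
      simpa using (hω x).2 0 zero_le_one
    obtain ⟨x, hx, hLx⟩ := exists_norm_eq_le_of_flow hlip hcont
      (α := fun x t => ψ t.toNNReal ω x) hψ0
      (fun x => (hω x).isIntegralCurveOn (hjoint hlip hcont) hFf) hL (hr₁.trans hr₁₂.le)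
    have h1 := hle x (Or.inr ⟨hx.ge, hx.le.trans hr₂₃.le⟩)
    rw [hz_annulus x hx.ge (hx.le.trans hr₂₃.le), abs_le] at h1
    rw [Real.toNNReal_one] at hLx
    linarith [h1.1]
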